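/- Let $\mathbf R\in\mathbb R^{E\times F}$, $\mathcal O\in\{0,1\}^{E\times T_1\times T_2}$, $\mathcal Y\in\mathbb R^{E\times T_1\times T_2}$, $\mathcal W\in\mathbb R_{>0}^{E\times T_1\times T_2}$, $\mathcal M\in\mathbb R_{>0}^{F\times T_1\times T_2}$, $\lambda>0$ and $\widetilde{\mathcal O}=\mathcal O\odot\mathcal W$. For $\mathbf P\in\mathbb R^{E\times N}$, $\mathbf Q_1\in\mathbb R^{T_1\times N}$, $\mathbf Q_2\in\mathbb R^{T_2\times N}$, $\mathcal A\in\mathbb R^{F\times T_1\times T_2}$ let $$f_{\mathrm{td}}(\mathbf P,\mathbf Q_1,\mathbf Q_2,\mathcal A)=\tfrac12\big\|\widetilde{\mathcal O}\odot(\mathcal Y-[\![\mathbf P,\mathbf Q_1,\mathbf Q_2]\!]-\mathcal A\times_1\mathbf R)\big\|_F^2+\tfrac\lambda2\big(\|\mathbf P\|_F^2+\|\mathbf Q_1\|_F^2+\|\mathbf Q_2\|_F^2\big)+\|\mathcal M\odot\mathcal A\|_1 ,$$ where $[\![\mathbf P,\mathbf Q_1,\mathbf Q_2]\!]_{j,t_1,t_2}=\sum_{r}\mathbf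 P_{j,r}(\mathbf Q_1)_{t_1,r}(\mathbf Q_2)_{t_2,r}$, $(\mathcal A\times_1\mathbf R)_{j,t_1,t_2}=\sum_i\mathbf R_{j,i}\mathcal A_{i,t_1,t_2}$, $\odot$ and $\oslash$ are entrywise multiplication and division, squares of tensors and of $\mathbf R$ are entrywise, and $\|\cdot\|_1$ is the entrywise $\ell_1$ norm. From arbitrary $\mathbf P^{0},\mathbf Q_1^{0},\mathbf Q_2^{0},\mathcal A^{0}$, Algorithm 1 computes for $\ell=1,2,\dots$: 1. $\mathbf P^{\ell}=\arg\min_{\mathbf P}f_{\mathrm{td}}(\mathbf P,\mathbf Q_1^{\ell-1},\mathbf Q_2^{\ell-1},\mathcal A^{\ell-1})$, then $\mathbf Q_1^{\ell}=\arg\min_{\mathbf Q_1}f_{\mathrm{td}}(\mathbf P^{\ell},\mathbf Q_1,\mathbf Q_2^{\ell-1},\mathcal A^{\ell-1})$, then $\mathbf Q_2^{\ell}=\arg\min_{\mathbf Q_2}f_{\mathrm{td}}(\mathbf P^{\ell},\mathbf Q_1^{\ell},\mathbf Q_2,\mathcal A^{\ell-1})$, each given row by row by the closed-form solution $(\mathbf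 K^{\mathsf T}\mathbf D\mathbf K+\lambda\mathbf I)^{-1}\mathbf K^{\mathsf T}\mathbf D\,\mathbf y$ of a weighted ridge regression. Here $\mathbf K$ is the Khatri–Rao product of the two fixed factor matrices, $\mathbf D$ is the diagonal matrix of the corresponding row of the unfolding of $\widetilde{\mathcal O}^2$, and $\mathbf y$ is the corresponding row of the unfolding of $\mathcal Y-\mathcal A^{\ell-1}\times_1\mathbf R$. 2. With $\mathcal X^\ell=[\![\mathbf P^\ell,\mathbf Q_1^\ell,\mathbf Q_2^\ell]\!]$ and $\mathcal D=\widetilde{\mathcal O}^2\times_1(\mathbf R^{2})^{\mathsf T}$, $$\widetilde{\mathcal A}^{\ell}=\mathcal S_{\mathcal M}\Big(\big[\widetilde{\mathcal O}^2\odot(\mathcal Y-\mathcal X^\ell-\mathcal A^{\ell-1}\times_1\mathbf R)\big]\times_1\mathbf R^{\mathsf T}+\mathcal D\odot\mathcal A^{\ell-1}\Big)\oslash\mathcal D ,$$ where $\mathcal S_{\mathcal M}$ is entrywise soft-thresholding, $\mathcal S_\mu(x)=\operatorname{sign}(x)\max(|x|-\mu,0)$, and an entry $0/0$ is read as $0$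 (where $\mathcal D$ vanishes, so does the numerator). 3. $\mathcal A^\ell=\mathcal A^{\ell-1}+\gamma^\ell(\widetilde{\mathcal A}^\ell-\mathcal A^{\ell-1})$, where $\gamma^\ell$ minimizes over $\gamma\in[0,1]$ the function $$\gamma\big(\|\mathcal M\odot\widetilde{\mathcal A}^\ell\|_1-\|\mathcal M\odot\mathcal A^{\ell-1}\|_1\big)+\tfrac12\big\|\widetilde{\mathcal O}\odot\big(\mathcal Y-\mathcal X^\ell-[\mathcal A^{\ell-1}+\gamma(\widetilde{\mathcal A}^\ell-\mathcal A^{\ell-1})]\times_1\mathbf R\big)\big\|_F^2 ;$$ it is given by the projection to $[0,1]$ of the unconstrained minimizer, and by $\gamma^\ell=1$ if the coefficient of $\gamma^2$ vanishes. Then every limit point (limit of a subsequence) of $(\mathbf P^{\ell},\mathbf Q_1^{\ell},\mathbf Q_2^{\ell},\mathcal A^{\ell})_{\ell}$ is a stationary point of the problem of minimizing $f_{\mathrm{td}}$, i.e. every one-sided directional derivative of $f_{\mathrm{td}}$ at this point exists and is nonnegative. -/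

import Mathlib

/-!  Robust tensor recovery with a CPD model: objective, block updates, and the iteration. -/

open scoped Matrix

noncomputable section

namespace TBSCA

/-- Real third-order tensors of size `I × J × K`.  The pointwise operations `+`, `-`, `*`
(Hadamard product), `/` (Hadamard division) and `^ 2` are those of functions. -/
abbrev Tensor (I J K : ℕ) : Type := Fin I → Fin J → Fin K → ℝ

/-- Sum of all entries of a tensor. -/
def entrySum {I J K : ℕ} (X : Tensor I J K) : ℝ := ∑ i, ∑ j, ∑ k, X i j k

/-- Squared Frobenius norm of a tensor. -/
def frobSq {I J K : ℕ} (X : Tensor I J K) : ℝ := ∑ i, ∑ j, ∑ k, X i j k ^ 2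

/-- Squared Frobenius norm of a matrix. -/
def matFrobSq {I J : ℕ} (X : Matrix (Fin I) (Fin J) ℝ) : ℝ := ∑ i, ∑ j, X i j ^ 2

/-- Entrywise `ℓ₁` norm of a tensor. -/
def l1norm {I J K : ℕ} (X : Tensor I J K) : ℝ := ∑ i, ∑ j, ∑ k, |X i j k|

/-- The mode-1 tensor-matrix product `A ×₁ R`. -/
def modeProd {I I' J K : ℕ} (A : Tensor I J K) (R : Matrix (Fin I') (Fin I) ℝ) : Tensor I' J K :=
  fun i' j k => ∑ i, R i' i * A i j k

/-- The CPD tensor `⟦A, B, C⟧ = ∑ r, A(:,r) ∘ B(:,r) ∘ C(:,r)`. -/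
def cpd {I J K N : ℕ} (A : Matrix (Fin I) (Fin N) ℝ) (B : Matrix (Fin J) (Fin N) ℝ)
    (C : Matrix (Fin K) (Fin N) ℝ) : Tensor I J K :=
  fun i j k => ∑ r, A i r * B j r * C k r

/-- Mode-1 unfolding (columns indexed by pairs, in the order matching `C ⊛ B`). -/
def unfold1 {I J K : ℕ} (X : Tensor I J K) : Matrix (Fin I) (Fin K × Fin J) ℝ :=
  Matrix.of fun i p => X i p.2 p.1

/-- Mode-2 unfolding (columns indexed by pairs, in the order matching `C ⊛ A`). -/
def unfold2 {I J K : ℕ} (X : Tensor I J K) : Matrix (Fin J) (Fin K × Fin I) ℝ :=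
  Matrix.of fun j p => X p.2 j p.1

/-- Mode-3 unfolding (columns indexed by pairs, in the order matching `B ⊛ A`). -/
def unfold3 {I J K : ℕ} (X : Tensor I J K) : Matrix (Fin K) (Fin J × Fin I) ℝ :=
  Matrix.of fun k p => X p.2 p.1 k

/-- The (columnwise) Khatri-Rao product. -/
def khatriRao {I J N : ℕ} (A : Matrix (Fin I) (Fin N) ℝ) (B : Matrix (Fin J) (Fin N) ℝ) :
    Matrix (Fin I × Fin J) (Fin N) ℝ :=
  Matrix.of fun p r => A p.1 r * B p.2 r

/-- Scalar soft-thresholding with threshold `μ`. -/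
def softThreshold (μ x : ℝ) : ℝ := Real.sign x * max (|x| - μ) 0

/-- The data of a recovery problem: numbers of links `E`, of flows `F`, periods `T₁`, `T₂`;
routing matrix `R`, observation mask `O`, measurements `Y`, weights `W`, sparsity
weights `M`, and regularization parameter `lam`. -/
structure Problem (E F T₁ T₂ : ℕ) where
  R : Matrix (Fin E) (Fin F) ℝ
  O : Tensor E T₁ T₂
  Y : Tensor E T₁ T₂
  W : Tensor E T₁ T₂
  M : Tensor F T₁ T₂
  lam : ℝ
  O_binary : ∀ j t₁ t₂, O j t₁ t₂ = 0 ∨ O j t₁ t₂ = 1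
  W_pos : ∀ j t₁ t₂, 0 < W j t₁ t₂
  M_pos : ∀ i t₁ t₂, 0 < M i t₁ t₂
  lam_pos : 0 < lam

/-- The space of variables `(P, Q₁, Q₂, A)`, with CPD size `N`. -/
abbrev Point (E F T₁ T₂ N : ℕ) : Type :=
  Matrix (Fin E) (Fin N) ℝ × Matrix (Fin T₁) (Fin N) ℝ × Matrix (Fin T₂) (Fin N) ℝ ×
    Tensor F T₁ T₂

namespace Problem

variable {E F T₁ T₂ N : ℕ} (S : Problem E F T₁ T₂)

/-- The weighted observation mask `Õ = O ⊙ W`. -/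
def Ow : Tensor E T₁ T₂ := S.O * S.W

/-- The objective `f_td`. -/
def objective (z : Point E F T₁ T₂ N) : ℝ :=
  1 / 2 * frobSq (S.Ow * (S.Y - cpd z.1 z.2.1 z.2.2.1 - modeProd z.2.2.2 S.R))
    + S.lam / 2 * (matFrobSq z.1 + matFrobSq z.2.1 + matFrobSq z.2.2.1)
    + l1norm (S.M * z.2.2.2)

/-- The weighted ridge solution `(Kᵀ Diag(w) K + lam I)⁻¹ Kᵀ Diag(w) y`. -/
def ridge {ι : Type} [Fintype ι] [DecidableEq ι] (lam : ℝ) (K : Matrix ι (Fin N) ℝ)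
    (w y : ι → ℝ) : Fin N → ℝ :=
  (Kᵀ * Matrix.diagonal w * K + lam • (1 : Matrix (Fin N) (Fin N) ℝ))⁻¹ *ᵥ
    ((Kᵀ * Matrix.diagonal w) *ᵥ y)

/-- The closed-form update of `P`. -/
def updateP (Q₁ : Matrix (Fin T₁) (Fin N) ℝ) (Q₂ : Matrix (Fin T₂) (Fin N) ℝ)
    (A : Tensor F T₁ T₂) : Matrix (Fin E) (Fin N) ℝ :=
  Matrix.of fun j => ridge S.lam (khatriRao Q₂ Q₁) (unfold1 (S.Ow ^ 2) j)
    (unfold1 S.Y j - unfold1 (modeProd A S.R) j)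

/-- The closed-form update of `Q₁`. -/
def updateQ₁ (P : Matrix (Fin E) (Fin N) ℝ) (Q₂ : Matrix (Fin T₂) (Fin N) ℝ)
    (A : Tensor F T₁ T₂) : Matrix (Fin T₁) (Fin N) ℝ :=
  Matrix.of fun t₁ => ridge S.lam (khatriRao Q₂ P) (unfold2 (S.Ow ^ 2) t₁)
    (unfold2 S.Y t₁ - unfold2 (modeProd A S.R) t₁)

/-- The closed-form update of `Q₂`. -/
def updateQ₂ (P : Matrix (Fin E) (Fin N) ℝ) (Q₁ : Matrix (Fin T₁) (Fin N) ℝ)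
    (A : Tensor F T₁ T₂) : Matrix (Fin T₂) (Fin N) ℝ :=
  Matrix.of fun t₂ => ridge S.lam (khatriRao Q₁ P) (unfold3 (S.Ow ^ 2) t₂)
    (unfold3 S.Y t₂ - unfold3 (modeProd A S.R) t₂)

/-- The tensor `Õ² ×₁ (R ⊙ R)ᵀ`. -/
def curvature : Tensor F T₁ T₂ := modeProd (S.Ow ^ 2) (S.R ⊙ S.R)ᵀ

/-- The soft-thresholding best response `Ã(X, A₀)`.  Where the `curvature` (the denominator)
vanishes, the numerator vanishes too, and the convention `0 / 0 = 0` returns `0`, which is the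
minimizer of the remaining term `M |a|` there. -/
def bestResponse (X : Tensor E T₁ T₂) (A₀ : Tensor F T₁ T₂) : Tensor F T₁ T₂ :=
  let B : Tensor F T₁ T₂ :=
    modeProd (S.Ow ^ 2 * (S.Y - X - modeProd A₀ S.R)) S.Rᵀ + S.curvature * A₀
  fun i t₁ t₂ => softThreshold (S.M i t₁ t₂) (B i t₁ t₂) / S.curvature i t₁ t₂

/-- The exact step size `γ*(X, Ã, A₀)`: the minimizer over `γ ∈ [0, 1]` of
`γ (‖M ⊙ Ã‖₁ - ‖M ⊙ A₀‖₁) + 1/2 ‖Õ ⊙ (Y - X - (A₀ + γ (Ã - A₀)) ×₁ R)‖²`.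
If the quadratic coefficient vanishes, this function is affine in `γ`, and for the best response
`Ã` it is nonincreasing, so that `1` is a minimizer. -/
def stepSize (X : Tensor E T₁ T₂) (At A₀ : Tensor F T₁ T₂) : ℝ :=
  if frobSq (S.Ow * modeProd (At - A₀) S.R) = 0 then 1
  else max 0 (min 1
    (-(entrySum (S.Ow ^ 2 * (X + modeProd A₀ S.R - S.Y) * modeProd (At - A₀) S.R)
        + l1norm (S.M * At) - l1norm (S.M * A₀))
      / frobSq (S.Ow * modeProd (At - A₀) S.R)))

/-- One pass of the algorithm: `P`, `Q₁`, `Q₂` in turn, then `A`. -/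
def step (z : Point E F T₁ T₂ N) : Point E F T₁ T₂ N :=
  let A₀ := z.2.2.2
  let P := S.updateP z.2.1 z.2.2.1 A₀
  let Q₁ := S.updateQ₁ P z.2.2.1 A₀
  let Q₂ := S.updateQ₂ P Q₁ A₀
  let X := cpd P Q₁ Q₂
  let At := S.bestResponse X A₀
  (P, Q₁, Q₂, A₀ + S.stepSize X At A₀ • (At - A₀))

/-- The iterate after `ℓ` passes, started from `z₀`. -/
def iterate (z₀ : Point E F T₁ T₂ N) : ℕ → Point E F T₁ T₂ N
  | 0 => z₀
  | ℓ + 1 => S.step (iterate z₀ ℓ)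

end Problem

/-- `x` is a stationary point of the unconstrained minimization of `f`: in every direction `d`
the one-sided directional derivative `f'(x; d)` exists and is nonnegative. -/
def IsStationaryPoint {V : Type*} [AddCommGroup V] [Module ℝ V] (f : V → ℝ) (x : V) : Prop :=
  ∀ d : V, ∃ s : ℝ, 0 ≤ s ∧ HasDerivWithinAt (fun t : ℝ => f (x + t • d)) s (Set.Ici 0) 0

end TBSCA

end

noncomputable section

namespace TBSCA
open Finset Filter Topology

/-! The objective never increases along the iteration, and a limit point must therefore be a point
that one more pass cannot improve. No boundedness of the iterates and no convergence of the whole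
sequence is needed: monotonicity and continuity bound every value on the orbit below by the value at
the limit point (`objective_le_iterate`).

The obstacle is that the exact step size may jump where the quadratic coefficient vanishes, so a
pass need not depend continuously on the point. It is avoided by comparing with a fixed step: the
exact step is at least as good as any constant `γ ≤ 1`, which gives `objective_step_le`, whose right
side is continuous in the point. In the limit, `objective z ≤ descentBound γ (sweep z)` for each `γ
≤ 1`.

With `γ = 0`, the strong convexity supplied by the ridge penalty forces the factor updates to fix
`z`. With a small `γ > 0`, the line search slope at `z` cannot be negative, so the `A`-block
minimizes all its scalar models. Since the only nonsmooth term is separable and involves `A` alone,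
these blockwise conditions add up to stationarity in every direction (`isStationaryPoint_of_fixed`).
-/

lemma matFrobSq_nonneg {I J : ℕ} (X : Matrix (Fin I) (Fin J) ℝ) : 0 ≤ matFrobSq X :=
  sum_nonneg fun _ _ => sum_nonneg fun _ _ => sq_nonneg _

lemma mul_matFrobSq_sub {I J : ℕ} (c : ℝ) (X Y : Matrix (Fin I) (Fin J) ℝ) :
    c * matFrobSq (X - Y) = ∑ i, c * ∑ j, (X i j - Y i j) ^ 2 := by
  simp only [matFrobSq, mul_sum, Matrix.sub_apply]

lemma eq_of_matFrobSq_sub_nonpos {I J : ℕ} {X Y : Matrix (Fin I) (Fin J) ℝ}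
    (h : matFrobSq (X - Y) ≤ 0) : X = Y := by
  have h0 := le_antisymm h (matFrobSq_nonneg _)
  ext i j
  simp only [matFrobSq, Matrix.sub_apply] at h0
  rw [sum_eq_zero_iff_of_nonneg fun _ _ => sum_nonneg fun _ _ => sq_nonneg _] at h0
  have h1 := h0 i (mem_univ _)
  rw [sum_eq_zero_iff_of_nonneg fun _ _ => sq_nonneg _] at h1
  exact sub_eq_zero.1 (pow_eq_zero_iff two_ne_zero |>.1 (h1 j (mem_univ _)))

namespace Problem

variable {E F T₁ T₂ N : ℕ} (S : Problem E F T₁ T₂)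

/-! ### Weighted ridge regression -/

section Ridge

variable {ι : Type} [Fintype ι] [DecidableEq ι]

/-- The weighted ridge regression loss. -/
def ridgeLoss (lam : ℝ) (K : Matrix ι (Fin N) ℝ) (w y : ι → ℝ) (x : Fin N → ℝ) : ℝ :=
  1 / 2 * ∑ p, w p * (y p - (K *ᵥ x) p) ^ 2 + lam / 2 * ∑ r, x r ^ 2

lemma isUnit_ridge_gram {lam : ℝ} (hlam : 0 < lam) (K : Matrix ι (Fin N) ℝ) {w : ι → ℝ}
    (hw : 0 ≤ w) :
    IsUnit (Kᵀ * Matrix.diagonal w * K + lam • (1 : Matrix (Fin N) (Fin N) ℝ)) := by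
  have h1 : (Kᵀ * Matrix.diagonal w * K).PosSemidef := by
    have := (Matrix.PosSemidef.diagonal hw).conjTranspose_mul_mul_same K
    rwa [Matrix.conjTranspose_eq_transpose_of_trivial] at this
  have h2 : (lam • (1 : Matrix (Fin N) (Fin N) ℝ)).PosDef := Matrix.PosDef.one.smul hlam
  exact (h2.posSemidef_add h1).isUnit

lemma ridge_normal_equation {lam : ℝ} (hlam : 0 < lam) (K : Matrix ι (Fin N) ℝ) {w : ι → ℝ}
    (hw : 0 ≤ w) (y : ι → ℝ) (r : Fin N) :
    ∑ p, K p r * (w p * (y p - (K *ᵥ ridge lam K w y) p)) = lam * ridge lam K w y r := by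
  have hu := (Matrix.isUnit_iff_isUnit_det _).1 (isUnit_ridge_gram hlam K hw)
  have h : (Kᵀ * Matrix.diagonal w * K + lam • (1 : Matrix (Fin N) (Fin N) ℝ)) *ᵥ ridge lam K w y
      = (Kᵀ * Matrix.diagonal w) *ᵥ y := by
    rw [ridge, Matrix.mulVec_mulVec, Matrix.mul_nonsing_inv _ hu, Matrix.one_mulVec]
  have h' := congrFun h r
  rw [Matrix.add_mulVec, Matrix.smul_mulVec, Matrix.one_mulVec, ← Matrix.mulVec_mulVec] at h'
  have key : ∀ v : ι → ℝ, ((Kᵀ * Matrix.diagonal w) *ᵥ v) r = ∑ p, K p r * (w p * v p) := by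
    intro v
    simp only [Matrix.mulVec, dotProduct, Matrix.mul_diagonal, Matrix.transpose_apply, mul_assoc]
  rw [Pi.add_apply, key, key, Pi.smul_apply, smul_eq_mul] at h'
  simp only [mul_sub, sum_sub_distrib]
  linarith

/-- Expanding around the ridge solution, the linear term cancels by the normal equation. The
weighted quadratic term is nonnegative and is dropped, so the penalty alone gives strong convexity
with modulus `lam`, whatever the rank of `K`. -/
lemma ridgeLoss_ridge_add_le {lam : ℝ} (hlam : 0 < lam) (K : Matrix ι (Fin N) ℝ) {w : ι → ℝ}
    (hw : 0 ≤ w) (y : ι → ℝ) (x : Fin N → ℝ) :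
    ridgeLoss lam K w y (ridge lam K w y) + lam / 2 * ∑ r, (x r - ridge lam K w y r) ^ 2
      ≤ ridgeLoss lam K w y x := by
  have hn := ridge_normal_equation hlam K hw y
  generalize ridge lam K w y = z at hn ⊢
  have hK : ∀ p, (K *ᵥ x) p = (K *ᵥ z) p + (K *ᵥ (x - z)) p := by
    intro p; simp [Matrix.mulVec_sub]
  have hcross : ∑ p, w p * (y p - (K *ᵥ z) p) * (K *ᵥ (x - z)) p
      = lam * ∑ r, z r * (x r - z r) := by
    simp only [Matrix.mulVec, dotProduct, mul_sum, Pi.sub_apply] at hn ⊢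
    rw [sum_comm]
    refine sum_congr rfl fun r _ => ?_
    rw [← mul_assoc, ← hn r, sum_mul]
    exact sum_congr rfl fun p _ => by ring
  have h1 : ∑ p, w p * (y p - (K *ᵥ x) p) ^ 2 = ∑ p, w p * (y p - (K *ᵥ z) p) ^ 2
      - 2 * ∑ p, w p * (y p - (K *ᵥ z) p) * (K *ᵥ (x - z)) p
      + ∑ p, w p * (K *ᵥ (x - z)) p ^ 2 := by
    rw [mul_sum, ← sum_sub_distrib, ← sum_add_distrib]
    exact sum_congr rfl fun p _ => by rw [hK]; ring
  have h2 : ∑ r, x r ^ 2 = ∑ r, z r ^ 2 + 2 * ∑ r, z r * (x r - z r) + ∑ r, (x r - z r) ^ 2 := by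
    rw [mul_sum, ← sum_add_distrib, ← sum_add_distrib]
    exact sum_congr rfl fun p _ => by ring
  have h3 : 0 ≤ ∑ p, w p * (K *ᵥ (x - z)) p ^ 2 :=
    sum_nonneg fun p _ => mul_nonneg (hw p) (sq_nonneg _)
  rw [ridgeLoss, ridgeLoss, h1, h2, hcross]
  linarith

/-- The regularized Gram matrix is positive definite for every `K`, so its determinant never
vanishes and the adjugate formula for the inverse is continuous. -/
lemma continuous_ridge {X : Type*} [TopologicalSpace X] {lam : ℝ} (hlam : 0 < lam)
    {K : X → Matrix ι (Fin N) ℝ} {w : ι → ℝ} {y : X → ι → ℝ} (hK : Continuous K) (hw : 0 ≤ w)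
    (hy : Continuous y) : Continuous fun x => ridge lam (K x) w (y x) := by
  have hG : Continuous fun x =>
      (K x)ᵀ * Matrix.diagonal w * K x + lam • (1 : Matrix (Fin N) (Fin N) ℝ) :=
    ((hK.matrix_transpose.matrix_mul continuous_const).matrix_mul hK).add continuous_const
  have hinv : Continuous fun x =>
      ((K x)ᵀ * Matrix.diagonal w * K x + lam • (1 : Matrix (Fin N) (Fin N) ℝ))⁻¹ := by
    simp only [Matrix.inv_def, Ring.inverse_eq_inv']
    exact (hG.matrix_det.inv₀ fun x =>
      ((Matrix.isUnit_iff_isUnit_det _).1 (isUnit_ridge_gram hlam (K x) hw)).ne_zero).smul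
        hG.matrix_adjugate
  exact hinv.matrix_mulVec ((hK.matrix_transpose.matrix_mul continuous_const).matrix_mulVec hy)

end Ridge

/-! ### Decoupling into rows and sufficient decrease of the factor updates -/

lemma objective_eq_sum_rows_P (P : Matrix (Fin E) (Fin N) ℝ) (Q₁ : Matrix (Fin T₁) (Fin N) ℝ)
    (Q₂ : Matrix (Fin T₂) (Fin N) ℝ) (A : Tensor F T₁ T₂) :
    S.objective (P, Q₁, Q₂, A) = ∑ j, ridgeLoss S.lam (khatriRao Q₂ Q₁) (unfold1 (S.Ow ^ 2) j)
      (unfold1 S.Y j - unfold1 (modeProd A S.R) j) (P j)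
      + (S.lam / 2 * (matFrobSq Q₁ + matFrobSq Q₂) + l1norm (S.M * A)) := by
  simp only [objective, ridgeLoss, sum_add_distrib, ← mul_sum]
  have : frobSq (S.Ow * (S.Y - cpd P Q₁ Q₂ - modeProd A S.R)) =
      ∑ j, ∑ p, unfold1 (S.Ow ^ 2) j p * ((unfold1 S.Y j - unfold1 (modeProd A S.R) j) p
        - (khatriRao Q₂ Q₁ *ᵥ P j) p) ^ 2 := by
    refine sum_congr rfl fun j _ => ?_
    rw [Fintype.sum_prod_type, sum_comm]
    refine sum_congr rfl fun k _ => sum_congr rfl fun i _ => ?_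
    have : (khatriRao Q₂ Q₁ *ᵥ P j) (k, i) = cpd P Q₁ Q₂ j i k := by
      simp only [Matrix.mulVec, dotProduct, cpd]
      exact sum_congr rfl fun r _ => by simp only [khatriRao, Matrix.of_apply]; ring
    rw [this]
    simp only [unfold1, Matrix.of_apply, Pi.mul_apply, Pi.sub_apply, Pi.pow_apply]
    ring
  rw [this]
  simp only [matFrobSq]
  ring

lemma objective_eq_sum_rows_Q₁ (P : Matrix (Fin E) (Fin N) ℝ) (Q₁ : Matrix (Fin T₁) (Fin N) ℝ)
    (Q₂ : Matrix (Fin T₂) (Fin N) ℝ) (A : Tensor F T₁ T₂) :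
    S.objective (P, Q₁, Q₂, A) = ∑ j, ridgeLoss S.lam (khatriRao Q₂ P) (unfold2 (S.Ow ^ 2) j)
      (unfold2 S.Y j - unfold2 (modeProd A S.R) j) (Q₁ j)
      + (S.lam / 2 * (matFrobSq P + matFrobSq Q₂) + l1norm (S.M * A)) := by
  simp only [objective, ridgeLoss, sum_add_distrib, ← mul_sum]
  have : frobSq (S.Ow * (S.Y - cpd P Q₁ Q₂ - modeProd A S.R)) =
      ∑ j, ∑ p, unfold2 (S.Ow ^ 2) j p * ((unfold2 S.Y j - unfold2 (modeProd A S.R) j) p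
        - (khatriRao Q₂ P *ᵥ Q₁ j) p) ^ 2 := by
    rw [frobSq, sum_comm]
    refine sum_congr rfl fun j _ => ?_
    rw [Fintype.sum_prod_type, sum_comm]
    refine sum_congr rfl fun k _ => sum_congr rfl fun i _ => ?_
    have : (khatriRao Q₂ P *ᵥ Q₁ j) (k, i) = cpd P Q₁ Q₂ i j k := by
      simp only [Matrix.mulVec, dotProduct, cpd]
      exact sum_congr rfl fun r _ => by simp only [khatriRao, Matrix.of_apply]; ring
    rw [this]
    simp only [unfold2, Matrix.of_apply, Pi.mul_apply, Pi.sub_apply, Pi.pow_apply]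
    ring
  rw [this]
  simp only [matFrobSq]
  ring

lemma objective_eq_sum_rows_Q₂ (P : Matrix (Fin E) (Fin N) ℝ) (Q₁ : Matrix (Fin T₁) (Fin N) ℝ)
    (Q₂ : Matrix (Fin T₂) (Fin N) ℝ) (A : Tensor F T₁ T₂) :
    S.objective (P, Q₁, Q₂, A) = ∑ j, ridgeLoss S.lam (khatriRao Q₁ P) (unfold3 (S.Ow ^ 2) j)
      (unfold3 S.Y j - unfold3 (modeProd A S.R) j) (Q₂ j)
      + (S.lam / 2 * (matFrobSq P + matFrobSq Q₁) + l1norm (S.M * A)) := by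
  simp only [objective, ridgeLoss, sum_add_distrib, ← mul_sum]
  have : frobSq (S.Ow * (S.Y - cpd P Q₁ Q₂ - modeProd A S.R)) =
      ∑ j, ∑ p, unfold3 (S.Ow ^ 2) j p * ((unfold3 S.Y j - unfold3 (modeProd A S.R) j) p
        - (khatriRao Q₁ P *ᵥ Q₂ j) p) ^ 2 := by
    simp only [Fintype.sum_prod_type]
    rw [frobSq, sum_comm, sum_comm (s := (univ : Finset (Fin T₂)))]
    refine sum_congr rfl fun i _ => ?_
    rw [sum_comm]
    refine sum_congr rfl fun k _ => sum_congr rfl fun j _ => ?_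
    have : (khatriRao Q₁ P *ᵥ Q₂ k) (i, j) = cpd P Q₁ Q₂ j i k := by
      simp only [Matrix.mulVec, dotProduct, cpd]
      exact sum_congr rfl fun r _ => by simp only [khatriRao, Matrix.of_apply]; ring
    rw [this]
    simp only [unfold3, Matrix.of_apply, Pi.mul_apply, Pi.sub_apply, Pi.pow_apply]
    ring
  rw [this]
  simp only [matFrobSq]
  ring

lemma objective_updateP_add_le (P : Matrix (Fin E) (Fin N) ℝ) (Q₁ : Matrix (Fin T₁) (Fin N) ℝ)
    (Q₂ : Matrix (Fin T₂) (Fin N) ℝ) (A : Tensor F T₁ T₂) :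
    S.objective (S.updateP Q₁ Q₂ A, Q₁, Q₂, A)
      + S.lam / 2 * matFrobSq (P - S.updateP Q₁ Q₂ A) ≤ S.objective (P, Q₁, Q₂, A) := by
  rw [objective_eq_sum_rows_P, objective_eq_sum_rows_P, mul_matFrobSq_sub, add_right_comm,
    ← sum_add_distrib]
  gcongr with j
  exact ridgeLoss_ridge_add_le S.lam_pos _ (fun p => sq_nonneg _) _ (P j)

lemma objective_updateQ₁_add_le (P : Matrix (Fin E) (Fin N) ℝ) (Q₁ : Matrix (Fin T₁) (Fin N) ℝ)
    (Q₂ : Matrix (Fin T₂) (Fin N) ℝ) (A : Tensor F T₁ T₂) :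
    S.objective (P, S.updateQ₁ P Q₂ A, Q₂, A)
      + S.lam / 2 * matFrobSq (Q₁ - S.updateQ₁ P Q₂ A) ≤ S.objective (P, Q₁, Q₂, A) := by
  rw [objective_eq_sum_rows_Q₁, objective_eq_sum_rows_Q₁, mul_matFrobSq_sub, add_right_comm,
    ← sum_add_distrib]
  gcongr with j
  exact ridgeLoss_ridge_add_le S.lam_pos _ (fun p => sq_nonneg _) _ (Q₁ j)

lemma objective_updateQ₂_add_le (P : Matrix (Fin E) (Fin N) ℝ) (Q₁ : Matrix (Fin T₁) (Fin N) ℝ)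
    (Q₂ : Matrix (Fin T₂) (Fin N) ℝ) (A : Tensor F T₁ T₂) :
    S.objective (P, Q₁, S.updateQ₂ P Q₁ A, A)
      + S.lam / 2 * matFrobSq (Q₂ - S.updateQ₂ P Q₁ A) ≤ S.objective (P, Q₁, Q₂, A) := by
  rw [objective_eq_sum_rows_Q₂, objective_eq_sum_rows_Q₂, mul_matFrobSq_sub, add_right_comm,
    ← sum_add_distrib]
  gcongr with j
  exact ridgeLoss_ridge_add_le S.lam_pos _ (fun p => sq_nonneg _) _ (Q₂ j)

end Problem

/-! ### Scalar models and soft-thresholding -/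

/-- The separable scalar model `g (a - a₀) + D / 2 (a - a₀)² + μ |a|`. -/
def scalarModel (D g a₀ μ a : ℝ) : ℝ := g * (a - a₀) + D / 2 * (a - a₀) ^ 2 + μ * |a|

lemma softThreshold_isMin {μ : ℝ} (hμ : 0 < μ) (b u : ℝ) :
    softThreshold μ b ^ 2 / 2 - b * softThreshold μ b + μ * |softThreshold μ b|
      ≤ u ^ 2 / 2 - b * u + μ * |u| := by
  have hu := le_abs_self u
  have hu' := neg_abs_le u
  have hus := sq_abs u
  rcases le_total |b| μ with hb | hb
  · have : softThreshold μ b = 0 := by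
      rw [softThreshold, max_eq_right (by linarith), mul_zero]
    rw [this]
    have h1 : b * u ≤ μ * |u| := (le_abs_self _).trans (by
      rw [abs_mul]; exact mul_le_mul_of_nonneg_right hb (abs_nonneg u))
    have := sq_nonneg u
    simp only [abs_zero]
    linarith
  · have hb0 : b ≠ 0 := fun h => by rw [h, abs_zero] at hb; linarith
    rcases lt_or_gt_of_ne hb0 with h | h
    · rw [abs_of_neg h] at hb
      have : softThreshold μ b = b + μ := by
        rw [softThreshold, Real.sign_of_neg h, abs_of_neg h, max_eq_left (by linarith)]; ring
      rw [this, abs_of_nonpos (by linarith)]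
      nlinarith [sq_nonneg (u - (b + μ)), mul_nonneg hμ.le (by linarith : 0 ≤ |u| + u)]
    · rw [abs_of_pos h] at hb
      have : softThreshold μ b = b - μ := by
        rw [softThreshold, Real.sign_of_pos h, abs_of_pos h, max_eq_left (by linarith)]; ring
      rw [this, abs_of_nonneg (by linarith)]
      nlinarith [sq_nonneg (u - (b - μ)), mul_nonneg hμ.le (by linarith : 0 ≤ |u| - u)]

/-- For `D > 0`, substituting `D * v` for the variable reduces to unit curvature. For `D = 0` only
`μ * |a|` is left, and Lean's `x / 0 = 0` returns its minimizer. -/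
lemma scalarModel_softThreshold_le {D g a₀ μ : ℝ} (hD : 0 ≤ D) (hμ : 0 < μ) (hg : D = 0 → g = 0)
    (a : ℝ) : scalarModel D g a₀ μ (softThreshold μ (-g + D * a₀) / D) ≤ scalarModel D g a₀ μ a := by
  rcases hD.eq_or_lt with h | h
  · rw [← h, hg h.symm]
    simp only [scalarModel, div_zero, abs_zero]
    have := mul_nonneg hμ.le (abs_nonneg a)
    linarith
  · have key : ∀ v, scalarModel D g a₀ μ v = (((D * v) ^ 2 / 2 - (-g + D * a₀) * (D * v)
        + μ * |D * v|) / D) + (D / 2 * a₀ ^ 2 - g * a₀) := by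
      intro v
      rw [scalarModel, abs_mul, abs_of_pos h]
      field_simp
      ring
    rw [key, key a, mul_div_cancel₀ _ h.ne']
    have := softThreshold_isMin hμ (-g + D * a₀) (D * a)
    gcongr

/-- The jump of the sign at `0` is invisible because the other factor vanishes near `0`; a
difference of two positive parts makes this explicit. -/
lemma continuous_softThreshold {μ : ℝ} (hμ : 0 < μ) : Continuous (softThreshold μ) := by
  have : softThreshold μ = fun x => max (x - μ) 0 - max (-x - μ) 0 := by
    ext x
    rcases lt_trichotomy x 0 with h | h | h
    · rw [softThreshold, Real.sign_of_neg h, abs_of_neg h,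
        max_eq_right (a := x - μ) (by linarith)]
      ring
    · rw [h, softThreshold, Real.sign_zero]; simp
    · rw [softThreshold, Real.sign_of_pos h, abs_of_pos h,
        max_eq_right (a := -x - μ) (by linarith)]
      ring
  rw [this]
  fun_prop

/-! ### Best response and exact line search -/

namespace Problem

variable {E F T₁ T₂ N : ℕ} (S : Problem E F T₁ T₂)

/-- The gradient with respect to `A` of the data-fitting term. -/
def gradA (X : Tensor E T₁ T₂) (A : Tensor F T₁ T₂) : Tensor F T₁ T₂ :=
  modeProd (S.Ow ^ 2 * (X + modeProd A S.R - S.Y)) S.Rᵀ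

/-- The slope at `0` of the line search function. -/
def slope (X : Tensor E T₁ T₂) (At A : Tensor F T₁ T₂) : ℝ :=
  entrySum (S.Ow ^ 2 * (X + modeProd A S.R - S.Y) * modeProd (At - A) S.R)
    + l1norm (S.M * At) - l1norm (S.M * A)

/-- The coefficient of `γ² / 2` in the line search function. -/
def quad (At A : Tensor F T₁ T₂) : ℝ := frobSq (S.Ow * modeProd (At - A) S.R)

lemma quad_nonneg (At A : Tensor F T₁ T₂) : 0 ≤ S.quad At A := by
  rw [quad, frobSq]
  exact sum_nonneg fun _ _ => sum_nonneg fun _ _ => sum_nonneg fun _ _ => sq_nonneg _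

/-- The mode-1 products with `R` and `Rᵀ` are adjoint. -/
lemma entrySum_mul_modeProd (Z : Tensor E T₁ T₂) (D : Tensor F T₁ T₂) :
    entrySum (Z * modeProd D S.R) = ∑ i, ∑ j, ∑ k, modeProd Z S.Rᵀ i j k * D i j k := by
  simp only [entrySum, modeProd, Pi.mul_apply, mul_sum, sum_mul, Matrix.transpose_apply]
  have h : ∀ e : Fin E, ∑ j, ∑ k, ∑ i, Z e j k * (S.R e i * D i j k)
      = ∑ i, ∑ j, ∑ k, S.R e i * Z e j k * D i j k := by
    intro e
    have : ∀ j : Fin T₁, ∑ k, ∑ i, Z e j k * (S.R e i * D i j k)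
        = ∑ i, ∑ k, S.R e i * Z e j k * D i j k := fun j => by
      rw [sum_comm]
      exact sum_congr rfl fun _ _ => sum_congr rfl fun _ _ => by ring
    rw [sum_congr rfl fun j _ => this j, sum_comm]
  rw [sum_congr rfl fun e _ => h e, sum_comm]
  refine sum_congr rfl fun i _ => ?_
  rw [sum_comm]
  exact sum_congr rfl fun j _ => sum_comm

lemma l1norm_M_mul (A : Tensor F T₁ T₂) :
    l1norm (S.M * A) = ∑ i, ∑ j, ∑ k, S.M i j k * |A i j k| := by
  simp only [l1norm, Pi.mul_apply, abs_mul, abs_of_pos (S.M_pos _ _ _)]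

lemma slope_eq (X : Tensor E T₁ T₂) (At A : Tensor F T₁ T₂) :
    S.slope X At A = ∑ i, ∑ j, ∑ k, (S.gradA X A i j k * (At i j k - A i j k)
      + S.M i j k * |At i j k| - S.M i j k * |A i j k|) := by
  rw [slope, entrySum_mul_modeProd, l1norm_M_mul, l1norm_M_mul]
  simp only [sum_add_distrib, sum_sub_distrib]
  rfl

lemma curvature_apply (i : Fin F) (j : Fin T₁) (k : Fin T₂) :
    S.curvature i j k = ∑ e, S.R e i * S.R e i * S.Ow e j k ^ 2 := rfl

lemma curvature_nonneg (i : Fin F) (j : Fin T₁) (k : Fin T₂) : 0 ≤ S.curvature i j k := by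
  rw [curvature_apply]
  exact sum_nonneg fun _ _ => mul_nonneg (mul_self_nonneg _) (sq_nonneg _)

/-- The curvature is a sum of squares, so if it vanishes then each factor `R e i` or `Ow e j k`
does, and with it each term of the gradient. -/
lemma gradA_eq_zero_of_curvature (X : Tensor E T₁ T₂) (A : Tensor F T₁ T₂) {i : Fin F}
    {j : Fin T₁} {k : Fin T₂} (h : S.curvature i j k = 0) : S.gradA X A i j k = 0 := by
  rw [curvature_apply, sum_eq_zero_iff_of_nonneg
    fun _ _ => mul_nonneg (mul_self_nonneg _) (sq_nonneg _)] at h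
  rw [gradA, modeProd]
  refine sum_eq_zero fun e _ => ?_
  simp only [Matrix.transpose_apply, Pi.mul_apply, Pi.pow_apply]
  rcases mul_eq_zero.1 (h e (mem_univ _)) with h0 | h0
  · rw [mul_self_eq_zero.1 h0, zero_mul]
  · rw [h0, zero_mul, mul_zero]

lemma bestResponse_apply (X : Tensor E T₁ T₂) (A : Tensor F T₁ T₂) (i : Fin F) (j : Fin T₁)
    (k : Fin T₂) : S.bestResponse X A i j k = softThreshold (S.M i j k)
      (-S.gradA X A i j k + S.curvature i j k * A i j k) / S.curvature i j k := by
  have : modeProd (S.Ow ^ 2 * (S.Y - X - modeProd A S.R)) S.Rᵀ i j k = -S.gradA X A i j k := by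
    simp only [gradA, modeProd, ← sum_neg_distrib]
    refine sum_congr rfl fun e _ => ?_
    simp only [Pi.mul_apply, Pi.sub_apply, Pi.add_apply]
    ring
  rw [← this]
  rfl

lemma scalarModel_bestResponse_le (X : Tensor E T₁ T₂) (A : Tensor F T₁ T₂) (i : Fin F)
    (j : Fin T₁) (k : Fin T₂) (a : ℝ) :
    scalarModel (S.curvature i j k) (S.gradA X A i j k) (A i j k) (S.M i j k)
        (S.bestResponse X A i j k)
      ≤ scalarModel (S.curvature i j k) (S.gradA X A i j k) (A i j k) (S.M i j k) a := by
  rw [bestResponse_apply]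
  exact scalarModel_softThreshold_le (S.curvature_nonneg i j k) (S.M_pos i j k)
    (S.gradA_eq_zero_of_curvature X A) a

/-- The two sides differ by the curvature term `D / 2 * (a - a₀) ^ 2`, which is nonnegative. The
right side is itself nonpositive by minimality of the best response. -/
lemma slope_summand_nonpos (X : Tensor E T₁ T₂) (A : Tensor F T₁ T₂) (i : Fin F)
    (j : Fin T₁) (k : Fin T₂) :
    S.gradA X A i j k * (S.bestResponse X A i j k - A i j k)
      + S.M i j k * |S.bestResponse X A i j k| - S.M i j k * |A i j k| ≤
    scalarModel (S.curvature i j k) (S.gradA X A i j k) (A i j k) (S.M i j k)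
        (S.bestResponse X A i j k) -
      scalarModel (S.curvature i j k) (S.gradA X A i j k) (A i j k) (S.M i j k) (A i j k) := by
  have := mul_nonneg (S.curvature_nonneg i j k)
    (sq_nonneg (S.bestResponse X A i j k - A i j k))
  simp only [scalarModel, sub_self]
  linarith

lemma slope_bestResponse_nonpos (X : Tensor E T₁ T₂) (A : Tensor F T₁ T₂) :
    S.slope X (S.bestResponse X A) A ≤ 0 := by
  rw [slope_eq]
  exact sum_nonpos fun i _ => sum_nonpos fun j _ => sum_nonpos fun k _ =>
    (S.slope_summand_nonpos X A i j k).trans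
      (sub_nonpos.2 (S.scalarModel_bestResponse_le X A i j k _))

/-- If the slope along the best response is nonnegative, then `A` itself minimizes every
scalar model. -/
lemma scalarModel_le_of_slope_nonneg {X : Tensor E T₁ T₂} {A : Tensor F T₁ T₂}
    (h : 0 ≤ S.slope X (S.bestResponse X A) A) (i : Fin F) (j : Fin T₁) (k : Fin T₂) (a : ℝ) :
    scalarModel (S.curvature i j k) (S.gradA X A i j k) (A i j k) (S.M i j k) (A i j k)
      ≤ scalarModel (S.curvature i j k) (S.gradA X A i j k) (A i j k) (S.M i j k) a := by
  have hle : ∀ i j k, S.gradA X A i j k * (S.bestResponse X A i j k - A i j k)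
      + S.M i j k * |S.bestResponse X A i j k| - S.M i j k * |A i j k| ≤ 0 := fun i j k =>
    (S.slope_summand_nonpos X A i j k).trans
      (sub_nonpos.2 (S.scalarModel_bestResponse_le X A i j k _))
  -- The slope is a sum of nonpositive terms equal to zero, so every term vanishes; then `A` does as
  -- well as the best response in each entry.
  have h0 := le_antisymm (S.slope_bestResponse_nonpos X A) h
  rw [slope_eq] at h0
  rw [sum_eq_zero_iff_of_nonpos fun i _ => sum_nonpos fun j _ => sum_nonpos fun k _ =>
    hle i j k] at h0
  have h1 := h0 i (mem_univ _)
  rw [sum_eq_zero_iff_of_nonpos fun j _ => sum_nonpos fun k _ => hle i j k] at h1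
  have h2 := h1 j (mem_univ _)
  rw [sum_eq_zero_iff_of_nonpos fun k _ => hle i j k] at h2
  have h3 := S.slope_summand_nonpos X A i j k
  rw [h2 k (mem_univ _), sub_nonneg] at h3
  exact h3.trans (S.scalarModel_bestResponse_le X A i j k a)

lemma frobSq_residual_lineSearch (X : Tensor E T₁ T₂) (At A : Tensor F T₁ T₂) (γ : ℝ) :
    frobSq (S.Ow * (S.Y - X - modeProd (A + γ • (At - A)) S.R))
      = frobSq (S.Ow * (S.Y - X - modeProd A S.R))
        + 2 * γ * entrySum (S.Ow ^ 2 * (X + modeProd A S.R - S.Y) * modeProd (At - A) S.R)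
        + γ ^ 2 * S.quad At A := by
  simp only [frobSq, entrySum, quad, mul_sum, ← sum_add_distrib]
  refine sum_congr rfl fun i _ => sum_congr rfl fun j _ => sum_congr rfl fun k _ => ?_
  have : modeProd (A + γ • (At - A)) S.R i j k
      = modeProd A S.R i j k + γ * modeProd (At - A) S.R i j k := by
    simp only [modeProd, mul_sum, ← sum_add_distrib]
    refine sum_congr rfl fun e _ => ?_
    simp only [Pi.add_apply, Pi.smul_apply, smul_eq_mul]
    ring
  simp only [Pi.mul_apply, Pi.sub_apply, Pi.add_apply, Pi.pow_apply, this]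
  ring

lemma l1norm_lineSearch_le (At A : Tensor F T₁ T₂) {γ : ℝ} (h0 : 0 ≤ γ) (h1 : γ ≤ 1) :
    l1norm (S.M * (A + γ • (At - A)))
      ≤ l1norm (S.M * A) + γ * (l1norm (S.M * At) - l1norm (S.M * A)) := by
  simp only [l1norm_M_mul, mul_sum, ← sum_add_distrib, ← sum_sub_distrib]
  refine sum_le_sum fun i _ => sum_le_sum fun j _ => sum_le_sum fun k _ => ?_
  have : |(A + γ • (At - A)) i j k| ≤ (1 - γ) * |A i j k| + γ * |At i j k| := by
    have e : (A + γ • (At - A)) i j k = (1 - γ) * A i j k + γ * At i j k := by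
      simp only [Pi.add_apply, Pi.smul_apply, Pi.sub_apply, smul_eq_mul]; ring
    rw [e]
    refine (abs_add_le _ _).trans_eq ?_
    rw [abs_mul, abs_mul, abs_of_nonneg h0, abs_of_nonneg (sub_nonneg.2 h1)]
  have := mul_le_mul_of_nonneg_left this (S.M_pos i j k).le
  linarith

/-- The data term is exactly quadratic in `γ`; convexity bounds the `ℓ₁` term by its chord, which is
where `γ ∈ [0, 1]` enters. -/
lemma objective_lineSearch_le (P : Matrix (Fin E) (Fin N) ℝ) (Q₁ : Matrix (Fin T₁) (Fin N) ℝ)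
    (Q₂ : Matrix (Fin T₂) (Fin N) ℝ) (At A : Tensor F T₁ T₂) {γ : ℝ} (h0 : 0 ≤ γ) (h1 : γ ≤ 1) :
    S.objective (P, Q₁, Q₂, A + γ • (At - A)) ≤ S.objective (P, Q₁, Q₂, A)
      + (γ * S.slope (cpd P Q₁ Q₂) At A + γ ^ 2 / 2 * S.quad At A) := by
  have := S.l1norm_lineSearch_le At A h0 h1
  simp only [objective, frobSq_residual_lineSearch, slope]
  linarith

lemma stepSize_mem (X : Tensor E T₁ T₂) (At A : Tensor F T₁ T₂) :
    0 ≤ S.stepSize X At A ∧ S.stepSize X At A ≤ 1 := by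
  rw [stepSize]
  split_ifs
  · norm_num
  · exact ⟨le_max_left _ _, max_le zero_le_one (min_le_left _ _)⟩

/-- The step size minimizes the line search function over `[0, 1]`. -/
lemma stepSize_isMin (X : Tensor E T₁ T₂) (A : Tensor F T₁ T₂) {γ : ℝ} (h1 : γ ≤ 1) :
    S.stepSize X (S.bestResponse X A) A * S.slope X (S.bestResponse X A) A
        + S.stepSize X (S.bestResponse X A) A ^ 2 / 2 * S.quad (S.bestResponse X A) A
      ≤ γ * S.slope X (S.bestResponse X A) A + γ ^ 2 / 2 * S.quad (S.bestResponse X A) A := by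
  have hs := S.slope_bestResponse_nonpos X A
  have hst : S.stepSize X (S.bestResponse X A) A = if S.quad (S.bestResponse X A) A = 0 then 1
      else max 0 (min 1 (-S.slope X (S.bestResponse X A) A / S.quad (S.bestResponse X A) A)) := rfl
  have hq := S.quad_nonneg (S.bestResponse X A) A
  rw [hst]
  generalize S.slope X (S.bestResponse X A) A = s at *
  generalize S.quad (S.bestResponse X A) A = q at *
  split_ifs with h
  · rw [h]; nlinarith
  · have hq' : 0 < q := lt_of_le_of_ne hq (Ne.symm h)
    -- Clipping at `0` is inactive because the slope is nonpositive; this is why the comparison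
    -- needs no lower bound on `γ`.
    rw [max_eq_right (le_min zero_le_one (div_nonneg (by linarith) hq))]
    rcases le_total 1 (-s / q) with h' | h'
    · rw [min_eq_left h']
      rw [le_div_iff₀ hq'] at h'
      -- The value at `γ` minus the value at `1` is `(1 - γ) * (-s - q) + q / 2 * (1 - γ) ^ 2`.
      nlinarith [mul_nonneg (sub_nonneg.2 h1) (by linarith : 0 ≤ -s - q),
        mul_nonneg hq (sq_nonneg (1 - γ))]
    · rw [min_eq_right h']
      have e : s = -(-s / q) * q := by field_simp
      generalize -s / q = t at *
      rw [e]
      nlinarith [mul_nonneg hq (sq_nonneg (t - γ))]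

/-! ### Descent over one pass -/

/-- The point reached after the three factor updates of one pass. -/
def sweep (z : Point E F T₁ T₂ N) : Point E F T₁ T₂ N :=
  let P := S.updateP z.2.1 z.2.2.1 z.2.2.2
  let Q₁ := S.updateQ₁ P z.2.2.1 z.2.2.2
  (P, Q₁, S.updateQ₂ P Q₁ z.2.2.2, z.2.2.2)

/-- Upper bound for the objective after one pass with step size `γ`. -/
def descentBound (γ : ℝ) (z : Point E F T₁ T₂ N) : ℝ :=
  S.objective z + (γ * S.slope (cpd z.1 z.2.1 z.2.2.1)
      (S.bestResponse (cpd z.1 z.2.1 z.2.2.1) z.2.2.2) z.2.2.2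
    + γ ^ 2 / 2 * S.quad (S.bestResponse (cpd z.1 z.2.1 z.2.2.1) z.2.2.2) z.2.2.2)

lemma descentBound_zero (z : Point E F T₁ T₂ N) : S.descentBound 0 z = S.objective z := by
  simp [descentBound]

lemma objective_step_le (z : Point E F T₁ T₂ N) {γ : ℝ} (h1 : γ ≤ 1) :
    S.objective (S.step z) ≤ S.descentBound γ (S.sweep z) :=
  (S.objective_lineSearch_le _ _ _ _ _ (S.stepSize_mem _ _ _).1 (S.stepSize_mem _ _ _).2).trans
    (add_le_add_right (S.stepSize_isMin _ _ h1) _)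

lemma objective_sweep_add_le (z : Point E F T₁ T₂ N) :
    S.objective (S.sweep z) + S.lam / 2 * (matFrobSq (z.1 - (S.sweep z).1)
      + matFrobSq (z.2.1 - (S.sweep z).2.1) + matFrobSq (z.2.2.1 - (S.sweep z).2.2.1))
      ≤ S.objective z := by
  obtain ⟨P, Q₁, Q₂, A⟩ := z
  have h1 := S.objective_updateP_add_le P Q₁ Q₂ A
  have h2 := S.objective_updateQ₁_add_le (S.updateP Q₁ Q₂ A) Q₁ Q₂ A
  have h3 := S.objective_updateQ₂_add_le (S.updateP Q₁ Q₂ A)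
    (S.updateQ₁ (S.updateP Q₁ Q₂ A) Q₂ A) Q₂ A
  simp only [sweep]
  linarith

lemma objective_sweep_le (z : Point E F T₁ T₂ N) :
    S.objective (S.sweep z) ≤ S.objective z := by
  refine le_trans (le_add_of_nonneg_right ?_) (S.objective_sweep_add_le z)
  have := S.lam_pos
  have := matFrobSq_nonneg (z.1 - (S.sweep z).1)
  have := matFrobSq_nonneg (z.2.1 - (S.sweep z).2.1)
  have := matFrobSq_nonneg (z.2.2.1 - (S.sweep z).2.2.1)
  positivity

/-- Without strict decrease, the strong convexity terms leave no room for any factor to move. -/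
lemma sweep_eq_self {z : Point E F T₁ T₂ N} (h : S.objective z ≤ S.objective (S.sweep z)) :
    S.sweep z = z := by
  have h0 := S.objective_sweep_add_le z
  have hs : matFrobSq (z.1 - (S.sweep z).1) + matFrobSq (z.2.1 - (S.sweep z).2.1)
      + matFrobSq (z.2.2.1 - (S.sweep z).2.2.1) ≤ 0 := by
    by_contra! hc
    have := mul_pos (half_pos S.lam_pos) hc
    linarith
  have h1 := matFrobSq_nonneg (z.1 - (S.sweep z).1)
  have h2 := matFrobSq_nonneg (z.2.1 - (S.sweep z).2.1)
  have h3 := matFrobSq_nonneg (z.2.2.1 - (S.sweep z).2.2.1)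
  have e1 := eq_of_matFrobSq_sub_nonpos (X := z.1) (Y := (S.sweep z).1) (by linarith)
  have e2 := eq_of_matFrobSq_sub_nonpos (X := z.2.1) (Y := (S.sweep z).2.1) (by linarith)
  have e3 := eq_of_matFrobSq_sub_nonpos (X := z.2.2.1) (Y := (S.sweep z).2.2.1) (by linarith)
  exact (Prod.ext e1 (Prod.ext e2 (Prod.ext e3 rfl))).symm

end Problem

/-! ### Continuity of the updates and of the descent bound -/

section Continuity

variable {X : Type*} [TopologicalSpace X] {I I' J K N : ℕ}

lemma continuous_tensor_apply {Z : X → Tensor I J K} (hZ : Continuous Z) (i : Fin I) (j : Fin J)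
    (k : Fin K) : Continuous fun x => Z x i j k :=
  (continuous_apply k).comp ((continuous_apply j).comp ((continuous_apply i).comp hZ))

lemma continuous_tensor {Z : X → Tensor I J K} (h : ∀ i j k, Continuous fun x => Z x i j k) :
    Continuous Z :=
  continuous_pi fun i => continuous_pi fun j => continuous_pi fun k => h i j k

lemma continuous_modeProd {Z : X → Tensor I J K} (hZ : Continuous Z)
    (R : Matrix (Fin I') (Fin I) ℝ) : Continuous fun x => modeProd (Z x) R :=
  continuous_tensor fun _ j k => continuous_finsetSum _ fun i _ =>
    continuous_const.mul (continuous_tensor_apply hZ i j k)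

lemma continuous_cpd {A : X → Matrix (Fin I) (Fin N) ℝ} {B : X → Matrix (Fin J) (Fin N) ℝ}
    {C : X → Matrix (Fin K) (Fin N) ℝ} (hA : Continuous A) (hB : Continuous B)
    (hC : Continuous C) : Continuous fun x => cpd (A x) (B x) (C x) :=
  continuous_tensor fun i j k => continuous_finsetSum _ fun r _ =>
    ((hA.matrix_elem i r).mul (hB.matrix_elem j r)).mul (hC.matrix_elem k r)

lemma continuous_entrySum {Z : X → Tensor I J K} (hZ : Continuous Z) :
    Continuous fun x => entrySum (Z x) :=
  continuous_finsetSum _ fun i _ => continuous_finsetSum _ fun j _ =>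
    continuous_finsetSum _ fun k _ => continuous_tensor_apply hZ i j k

lemma continuous_frobSq {Z : X → Tensor I J K} (hZ : Continuous Z) :
    Continuous fun x => frobSq (Z x) :=
  continuous_finsetSum _ fun i _ => continuous_finsetSum _ fun j _ =>
    continuous_finsetSum _ fun k _ => (continuous_tensor_apply hZ i j k).pow 2

lemma continuous_l1norm {Z : X → Tensor I J K} (hZ : Continuous Z) :
    Continuous fun x => l1norm (Z x) :=
  continuous_finsetSum _ fun i _ => continuous_finsetSum _ fun j _ =>
    continuous_finsetSum _ fun k _ => (continuous_tensor_apply hZ i j k).abs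

lemma continuous_matFrobSq {Z : X → Matrix (Fin I) (Fin J) ℝ} (hZ : Continuous Z) :
    Continuous fun x => matFrobSq (Z x) :=
  continuous_finsetSum _ fun i _ => continuous_finsetSum _ fun j _ => (hZ.matrix_elem i j).pow 2

lemma continuous_khatriRao {A : X → Matrix (Fin I) (Fin N) ℝ} {B : X → Matrix (Fin J) (Fin N) ℝ}
    (hA : Continuous A) (hB : Continuous B) : Continuous fun x => khatriRao (A x) (B x) :=
  continuous_matrix fun p r => (hA.matrix_elem p.1 r).mul (hB.matrix_elem p.2 r)

end Continuity

namespace Problem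

variable {E F T₁ T₂ N : ℕ} (S : Problem E F T₁ T₂)

section Continuity

variable {X : Type*} [TopologicalSpace X] {P : X → Matrix (Fin E) (Fin N) ℝ}
  {Q₁ : X → Matrix (Fin T₁) (Fin N) ℝ} {Q₂ : X → Matrix (Fin T₂) (Fin N) ℝ}
  {A : X → Tensor F T₁ T₂}

lemma continuous_updateP (hQ₁ : Continuous Q₁) (hQ₂ : Continuous Q₂) (hA : Continuous A) :
    Continuous fun x => S.updateP (Q₁ x) (Q₂ x) (A x) :=
  continuous_matrix fun j r => (continuous_apply r).comp <|
    continuous_ridge S.lam_pos (continuous_khatriRao hQ₂ hQ₁) (fun _ => sq_nonneg _) <|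
      continuous_const.sub <| continuous_pi fun p =>
        continuous_tensor_apply (continuous_modeProd hA S.R) j p.2 p.1

lemma continuous_updateQ₁ (hP : Continuous P) (hQ₂ : Continuous Q₂) (hA : Continuous A) :
    Continuous fun x => S.updateQ₁ (P x) (Q₂ x) (A x) :=
  continuous_matrix fun j r => (continuous_apply r).comp <|
    continuous_ridge S.lam_pos (continuous_khatriRao hQ₂ hP) (fun _ => sq_nonneg _) <|
      continuous_const.sub <| continuous_pi fun p =>
        continuous_tensor_apply (continuous_modeProd hA S.R) p.2 j p.1

lemma continuous_updateQ₂ (hP : Continuous P) (hQ₁ : Continuous Q₁) (hA : Continuous A) :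
    Continuous fun x => S.updateQ₂ (P x) (Q₁ x) (A x) :=
  continuous_matrix fun j r => (continuous_apply r).comp <|
    continuous_ridge S.lam_pos (continuous_khatriRao hQ₁ hP) (fun _ => sq_nonneg _) <|
      continuous_const.sub <| continuous_pi fun p =>
        continuous_tensor_apply (continuous_modeProd hA S.R) p.2 p.1 j

lemma continuous_sweep : Continuous (S.sweep (N := N)) := by
  have hQ₁ : Continuous fun z : Point E F T₁ T₂ N => z.2.1 := by fun_prop
  have hQ₂ : Continuous fun z : Point E F T₁ T₂ N => z.2.2.1 := by fun_prop
  have hA : Continuous fun z : Point E F T₁ T₂ N => z.2.2.2 := by fun_prop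
  have hP' := S.continuous_updateP hQ₁ hQ₂ hA
  have hQ₁' := S.continuous_updateQ₁ hP' hQ₂ hA
  have hQ₂' := S.continuous_updateQ₂ hP' hQ₁' hA
  exact hP'.prodMk (hQ₁'.prodMk (hQ₂'.prodMk hA))

lemma continuous_objective : Continuous (S.objective (N := N)) := by
  have hP : Continuous fun z : Point E F T₁ T₂ N => z.1 := by fun_prop
  have hQ₁ : Continuous fun z : Point E F T₁ T₂ N => z.2.1 := by fun_prop
  have hQ₂ : Continuous fun z : Point E F T₁ T₂ N => z.2.2.1 := by fun_prop
  have hA : Continuous fun z : Point E F T₁ T₂ N => z.2.2.2 := by fun_prop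
  exact ((continuous_const.mul (continuous_frobSq (continuous_const.mul
    ((continuous_const.sub (continuous_cpd hP hQ₁ hQ₂)).sub (continuous_modeProd hA S.R))))).add
    (continuous_const.mul (((continuous_matFrobSq hP).add (continuous_matFrobSq hQ₁)).add
      (continuous_matFrobSq hQ₂)))).add (continuous_l1norm (continuous_const.mul hA))

lemma continuous_gradA {Z : X → Tensor E T₁ T₂} (hZ : Continuous Z) (hA : Continuous A) :
    Continuous fun x => S.gradA (Z x) (A x) :=
  continuous_modeProd (continuous_const.mul
    ((hZ.add (continuous_modeProd hA S.R)).sub continuous_const)) _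

lemma continuous_bestResponse {Z : X → Tensor E T₁ T₂} (hZ : Continuous Z) (hA : Continuous A) :
    Continuous fun x => S.bestResponse (Z x) (A x) := by
  refine continuous_tensor fun i j k => ?_
  simp only [bestResponse_apply]
  exact ((continuous_softThreshold (S.M_pos i j k)).comp
    ((continuous_tensor_apply (S.continuous_gradA hZ hA) i j k).neg.add
      (continuous_const.mul (continuous_tensor_apply hA i j k)))).div_const _

lemma continuous_descentBound (γ : ℝ) : Continuous (S.descentBound (N := N) γ) := by
  have hP : Continuous fun z : Point E F T₁ T₂ N => z.1 := by fun_prop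
  have hQ₁ : Continuous fun z : Point E F T₁ T₂ N => z.2.1 := by fun_prop
  have hQ₂ : Continuous fun z : Point E F T₁ T₂ N => z.2.2.1 := by fun_prop
  have hA : Continuous fun z : Point E F T₁ T₂ N => z.2.2.2 := by fun_prop
  have hX := continuous_cpd hP hQ₁ hQ₂
  have hB := S.continuous_bestResponse hX hA
  have hD := continuous_modeProd (hB.sub hA) S.R
  have hs := ((continuous_entrySum (((continuous_const (y := S.Ow ^ 2)).mul
    ((hX.add (continuous_modeProd hA S.R)).sub (continuous_const (y := S.Y)))).mul hD)).add
      (continuous_l1norm ((continuous_const (y := S.M)).mul hB))).sub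
        (continuous_l1norm ((continuous_const (y := S.M)).mul hA))
  have hq := continuous_frobSq ((continuous_const (y := S.Ow)).mul hD)
  exact S.continuous_objective.add
    (((continuous_const (y := γ)).mul hs).add ((continuous_const (y := γ ^ 2 / 2)).mul hq))

end Continuity

/-! ### Limit points are fixed points -/

lemma objective_step_le_objective (z : Point E F T₁ T₂ N) :
    S.objective (S.step z) ≤ S.objective z :=
  (S.objective_step_le z zero_le_one).trans
    ((S.descentBound_zero _).trans_le (S.objective_sweep_le z))

lemma objective_iterate_antitone (z₀ : Point E F T₁ T₂ N) :
    Antitone fun n => S.objective (S.iterate z₀ n) :=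
  antitone_nat_of_succ_le fun n => S.objective_step_le_objective (S.iterate z₀ n)

/-- Were an iterate strictly below, the objective would exceed that value throughout a neighbourhood
of `z`, to which later iterates return, against monotonicity. -/
lemma objective_le_iterate {z₀ z : Point E F T₁ T₂ N}
    (hz : MapClusterPt z atTop (S.iterate z₀)) (n : ℕ) :
    S.objective z ≤ S.objective (S.iterate z₀ n) := by
  by_contra! h
  have hev := S.continuous_objective.continuousAt.eventually (lt_mem_nhds h)
  obtain ⟨m, hm, hm'⟩ := ((mapClusterPt_iff_frequently.1 hz _ hev).and_eventually
    (eventually_ge_atTop n)).exists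
  exact absurd (S.objective_iterate_antitone z₀ hm') (not_le.2 hm)

/-- If it failed, then by continuity an iterate close to `z` would have a successor below `objective
z`. Keeping `γ` fixed is what makes the bound continuous. -/
lemma objective_le_descentBound {z₀ z : Point E F T₁ T₂ N}
    (hz : MapClusterPt z atTop (S.iterate z₀)) {γ : ℝ} (h1 : γ ≤ 1) :
    S.objective z ≤ S.descentBound γ (S.sweep z) := by
  by_contra! h
  have hev := ((S.continuous_descentBound γ).comp S.continuous_sweep).continuousAt.eventually
    (gt_mem_nhds h)
  obtain ⟨m, hm⟩ := (mapClusterPt_iff_frequently.1 hz _ hev).exists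
  exact absurd ((S.objective_le_iterate hz (m + 1)).trans (S.objective_step_le _ h1))
    (not_le.2 hm)

lemma sweep_eq_self_of_mapClusterPt {z₀ z : Point E F T₁ T₂ N}
    (hz : MapClusterPt z atTop (S.iterate z₀)) : S.sweep z = z :=
  S.sweep_eq_self ((S.objective_le_descentBound hz zero_le_one).trans_eq (S.descentBound_zero _))

lemma slope_nonneg_of_mapClusterPt {z₀ z : Point E F T₁ T₂ N}
    (hz : MapClusterPt z atTop (S.iterate z₀)) :
    0 ≤ S.slope (cpd z.1 z.2.1 z.2.2.1)
      (S.bestResponse (cpd z.1 z.2.1 z.2.2.1) z.2.2.2) z.2.2.2 := by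
  have h : ∀ γ ≤ 1, S.objective z ≤ S.descentBound γ z := fun γ hγ => by
    have := S.objective_le_descentBound hz hγ
    rwa [S.sweep_eq_self_of_mapClusterPt hz] at this
  simp only [descentBound] at h
  have hq := S.quad_nonneg (S.bestResponse (cpd z.1 z.2.1 z.2.2.1) z.2.2.2) z.2.2.2
  generalize S.slope _ _ _ = s at *
  generalize S.quad _ _ = q at *
  by_contra! hs
  have hd : 0 < q - s := by linarith
  -- The unconstrained minimizer `-s / q` is damped to `-s / (q - s)`: this lies in `(0, 1]`, makes
  -- sense even for `q = 0`, and still decreases the bound strictly.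
  have h1 := h (-s / (q - s)) ((div_le_one hd).2 (by linarith))
  have e : -s / (q - s) * s + (-s / (q - s)) ^ 2 / 2 * q = -(s / (q - s)) ^ 2 * (q / 2 - s) := by
    field_simp; ring
  have : 0 < (s / (q - s)) ^ 2 * (q / 2 - s) :=
    mul_pos (sq_pos_of_ne_zero (div_ne_zero hs.ne hd.ne')) (by linarith)
  linarith

end Problem

/-! ### Directional derivatives -/

lemma nonneg_of_hasDerivWithinAt_of_isMin {f : ℝ → ℝ} {s : ℝ}
    (h : HasDerivWithinAt f s (Set.Ici 0) 0) (hmin : ∀ t, f 0 ≤ f t) : 0 ≤ s := by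
  rw [hasDerivWithinAt_iff_tendsto_slope, Set.Ici_sdiff_left] at h
  refine ge_of_tendsto h ?_
  filter_upwards [self_mem_nhdsWithin] with t ht
  rw [slope_def_field]
  exact div_nonneg (sub_nonneg.2 (hmin t)) (by simpa using (Set.mem_Ioi.1 ht).le)

lemma exists_hasDerivWithinAt_abs (a d : ℝ) :
    ∃ s, HasDerivWithinAt (fun t : ℝ => |a + t * d|) s (Set.Ici 0) 0 := by
  rcases eq_or_ne a 0 with rfl | ha
  · refine ⟨|d|, ?_⟩
    have : HasDerivWithinAt (fun t : ℝ => t * |d|) |d| (Set.Ici 0) 0 := by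
      simpa using ((hasDerivAt_id (0 : ℝ)).mul_const |d|).hasDerivWithinAt (s := Set.Ici 0)
    refine this.congr (fun t ht => ?_) (by simp)
    rw [zero_add, abs_mul, abs_of_nonneg (Set.mem_Ici.1 ht)]
  · have h : HasDerivAt (fun t : ℝ => a + t * d) d 0 := by
      simpa using ((hasDerivAt_id (0 : ℝ)).mul_const d).const_add a
    exact ⟨_, (HasDerivAt.comp (h₂ := fun x : ℝ => |x|) (0 : ℝ)
      (hasDerivAt_abs (by simpa using ha)) h).hasDerivWithinAt⟩

/-- The curvature term is of second order at the centre `a`, so it does not contribute to the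
one-sided derivative. -/
lemma scalarModel_directional_nonneg {D g a μ d s : ℝ}
    (hmin : ∀ u, scalarModel D g a μ a ≤ scalarModel D g a μ u)
    (hs : HasDerivWithinAt (fun t : ℝ => |a + t * d|) s (Set.Ici 0) 0) : 0 ≤ g * d + μ * s := by
  have h1 : HasDerivAt (fun t : ℝ => g * (t * d) + D / 2 * (t * d) ^ 2) (g * d) 0 := by
    have h := (hasDerivAt_id (0 : ℝ)).mul_const d
    simpa using (h.const_mul g).fun_add ((h.fun_pow 2).const_mul (D / 2))
  refine nonneg_of_hasDerivWithinAt_of_isMin (h1.hasDerivWithinAt.add (hs.const_mul μ)) fun t => ?_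
  simpa [scalarModel] using hmin (a + t * d)

/-- The Frobenius inner product of matrices. -/
def matInner {I J : ℕ} (X Y : Matrix (Fin I) (Fin J) ℝ) : ℝ := ∑ i, ∑ j, X i j * Y i j

lemma hasDerivAt_matFrobSq {I J : ℕ} (X D : Matrix (Fin I) (Fin J) ℝ) :
    HasDerivAt (fun t : ℝ => matFrobSq (X + t • D)) (2 * matInner X D) 0 := by
  simp only [matFrobSq, matInner, mul_sum]
  refine HasDerivAt.fun_sum fun i _ => HasDerivAt.fun_sum fun j _ => ?_
  have h : HasDerivAt (fun t : ℝ => X i j + t * D i j) (D i j) 0 := by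
    simpa using ((hasDerivAt_id (0 : ℝ)).mul_const (D i j)).const_add (X i j)
  refine (h.fun_pow 2).congr_deriv ?_
  push_cast; ring

namespace Problem

variable {E F T₁ T₂ N : ℕ} (S : Problem E F T₁ T₂)

/-- The differentiable part of the objective. -/
def smoothPart (z : Point E F T₁ T₂ N) : ℝ :=
  1 / 2 * frobSq (S.Ow * (S.Y - cpd z.1 z.2.1 z.2.2.1 - modeProd z.2.2.2 S.R))
    + S.lam / 2 * (matFrobSq z.1 + matFrobSq z.2.1 + matFrobSq z.2.2.1)

lemma objective_eq (z : Point E F T₁ T₂ N) :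
    S.objective z = S.smoothPart z + l1norm (S.M * z.2.2.2) := rfl

/-- The gradient of the data-fitting term with respect to the predicted measurements. -/
def fitGrad (z : Point E F T₁ T₂ N) : Tensor E T₁ T₂ :=
  S.Ow ^ 2 * (cpd z.1 z.2.1 z.2.2.1 + modeProd z.2.2.2 S.R - S.Y)

/-- The directional derivative of the differentiable part of the objective. -/
def smoothDeriv (z d : Point E F T₁ T₂ N) : ℝ :=
  (entrySum (S.fitGrad z * cpd d.1 z.2.1 z.2.2.1) + S.lam * matInner z.1 d.1)
    + (entrySum (S.fitGrad z * cpd z.1 d.2.1 z.2.2.1) + S.lam * matInner z.2.1 d.2.1)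
    + (entrySum (S.fitGrad z * cpd z.1 z.2.1 d.2.2.1) + S.lam * matInner z.2.2.1 d.2.2.1)
    + entrySum (S.fitGrad z * modeProd d.2.2.2 S.R)

lemma hasDerivAt_residual (z d : Point E F T₁ T₂ N) (i : Fin E) (j : Fin T₁) (k : Fin T₂) :
    HasDerivAt (fun t : ℝ => (S.Y - cpd (z + t • d).1 (z + t • d).2.1 (z + t • d).2.2.1
        - modeProd (z + t • d).2.2.2 S.R) i j k)
      (-(cpd d.1 z.2.1 z.2.2.1 i j k + cpd z.1 d.2.1 z.2.2.1 i j k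
        + cpd z.1 z.2.1 d.2.2.1 i j k + modeProd d.2.2.2 S.R i j k)) 0 := by
  have lin : ∀ a b : ℝ, HasDerivAt (fun t : ℝ => a + t * b) b 0 := fun a b => by
    simpa using ((hasDerivAt_id (0 : ℝ)).mul_const b).const_add a
  have hc : HasDerivAt (fun t : ℝ => cpd (z + t • d).1 (z + t • d).2.1 (z + t • d).2.2.1 i j k)
      (cpd d.1 z.2.1 z.2.2.1 i j k + cpd z.1 d.2.1 z.2.2.1 i j k
        + cpd z.1 z.2.1 d.2.2.1 i j k) 0 := by
    simp only [cpd, ← sum_add_distrib]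
    refine HasDerivAt.fun_sum fun r _ => ?_
    have h := ((lin (z.1 i r) (d.1 i r)).fun_mul (lin (z.2.1 j r) (d.2.1 j r))).fun_mul
      (lin (z.2.2.1 k r) (d.2.2.1 k r))
    refine h.congr_deriv ?_
    ring
  have hm : HasDerivAt (fun t : ℝ => modeProd (z + t • d).2.2.2 S.R i j k)
      (modeProd d.2.2.2 S.R i j k) 0 :=
    HasDerivAt.fun_sum fun r _ => (lin (z.2.2.2 r j k) (d.2.2.2 r j k)).const_mul (S.R i r)
  refine ((hc.const_sub (S.Y i j k)).fun_sub hm).congr_deriv ?_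
  ring

lemma hasDerivAt_smoothPart (z d : Point E F T₁ T₂ N) :
    HasDerivAt (fun t : ℝ => S.smoothPart (z + t • d)) (S.smoothDeriv z d) 0 := by
  have h1 : HasDerivAt (fun t : ℝ => frobSq (S.Ow * (S.Y
      - cpd (z + t • d).1 (z + t • d).2.1 (z + t • d).2.2.1 - modeProd (z + t • d).2.2.2 S.R)))
      (∑ i, ∑ j, ∑ k, 2 * (S.fitGrad z i j k * (cpd d.1 z.2.1 z.2.2.1 i j k
        + cpd z.1 d.2.1 z.2.2.1 i j k + cpd z.1 z.2.1 d.2.2.1 i j k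
        + modeProd d.2.2.2 S.R i j k))) 0 := by
    refine HasDerivAt.fun_sum fun i _ => HasDerivAt.fun_sum fun j _ =>
      HasDerivAt.fun_sum fun k _ => ?_
    have h := ((S.hasDerivAt_residual z d i j k).const_mul (S.Ow i j k)).fun_pow 2
    refine h.congr_deriv ?_
    simp only [zero_smul, add_zero, fitGrad, Pi.mul_apply, Pi.sub_apply, Pi.add_apply,
      Pi.pow_apply]
    push_cast
    ring
  have h2 := ((hasDerivAt_matFrobSq z.1 d.1).fun_add (hasDerivAt_matFrobSq z.2.1 d.2.1)).fun_add
    (hasDerivAt_matFrobSq z.2.2.1 d.2.2.1)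
  refine ((h1.const_mul (1 / 2)).fun_add (h2.const_mul (S.lam / 2))).congr_deriv ?_
  simp only [smoothDeriv, entrySum, Pi.mul_apply, mul_add, sum_add_distrib, ← mul_sum]
  ring

lemma hasDerivWithinAt_l1norm {A D s : Tensor F T₁ T₂}
    (hs : ∀ i j k, HasDerivWithinAt (fun t : ℝ => |A i j k + t * D i j k|) (s i j k)
      (Set.Ici 0) 0) :
    HasDerivWithinAt (fun t : ℝ => l1norm (S.M * (A + t • D)))
      (∑ i, ∑ j, ∑ k, S.M i j k * s i j k) (Set.Ici 0) 0 := by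
  simp only [l1norm_M_mul]
  exact HasDerivWithinAt.fun_sum fun i _ => HasDerivWithinAt.fun_sum fun j _ =>
    HasDerivWithinAt.fun_sum fun k _ => (hs i j k).const_mul (S.M i j k)

lemma cpd_zero_left {I J K : ℕ} (B : Matrix (Fin J) (Fin N) ℝ) (C : Matrix (Fin K) (Fin N) ℝ) :
    cpd (0 : Matrix (Fin I) (Fin N) ℝ) B C = 0 := by
  ext i j k; simp [cpd]

lemma cpd_zero_mid {I J K : ℕ} (A : Matrix (Fin I) (Fin N) ℝ) (C : Matrix (Fin K) (Fin N) ℝ) :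
    cpd A (0 : Matrix (Fin J) (Fin N) ℝ) C = 0 := by
  ext i j k; simp [cpd]

lemma cpd_zero_right {I J K : ℕ} (A : Matrix (Fin I) (Fin N) ℝ) (B : Matrix (Fin J) (Fin N) ℝ) :
    cpd A B (0 : Matrix (Fin K) (Fin N) ℝ) = 0 := by
  ext i j k; simp [cpd]

lemma modeProd_zero {I I' J K : ℕ} (R : Matrix (Fin I') (Fin I) ℝ) :
    modeProd (0 : Tensor I J K) R = 0 := by
  ext i j k; simp [modeProd]

lemma entrySum_zero {I J K : ℕ} : entrySum (0 : Tensor I J K) = 0 := by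
  simp [entrySum]

lemma matInner_zero {I J : ℕ} (X : Matrix (Fin I) (Fin J) ℝ) : matInner X 0 = 0 := by
  simp [matInner]

/-- If the objective is minimal at `z` along the direction `d`, which leaves `A` fixed, then the
directional derivative of the differentiable part is nonnegative. -/
lemma smoothDeriv_nonneg {z d : Point E F T₁ T₂ N} (hd : d.2.2.2 = 0)
    (hmin : ∀ t : ℝ, S.objective z ≤ S.objective (z + t • d)) : 0 ≤ S.smoothDeriv z d := by
  refine nonneg_of_hasDerivWithinAt_of_isMin (S.hasDerivAt_smoothPart z d).hasDerivWithinAt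
    fun t => ?_
  have h := hmin t
  have e : (z + t • d).2.2.2 = z.2.2.2 := by simp [hd]
  rw [objective_eq, objective_eq, e] at h
  rw [zero_smul, add_zero]
  linarith

lemma smoothDeriv_nonneg_P {P : Matrix (Fin E) (Fin N) ℝ} {Q₁ : Matrix (Fin T₁) (Fin N) ℝ}
    {Q₂ : Matrix (Fin T₂) (Fin N) ℝ} {A : Tensor F T₁ T₂}
    (hmin : ∀ P', S.objective (P, Q₁, Q₂, A) ≤ S.objective (P', Q₁, Q₂, A))
    (D : Matrix (Fin E) (Fin N) ℝ) :
    0 ≤ entrySum (S.fitGrad (P, Q₁, Q₂, A) * cpd D Q₁ Q₂) + S.lam * matInner P D := by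
  have h := S.smoothDeriv_nonneg (z := (P, Q₁, Q₂, A)) (d := (D, 0, 0, 0)) rfl
    fun t => by simpa using hmin (P + t • D)
  simpa [smoothDeriv, cpd_zero_mid, cpd_zero_right, modeProd_zero, entrySum_zero, matInner_zero]
    using h

lemma smoothDeriv_nonneg_Q₁ {P : Matrix (Fin E) (Fin N) ℝ} {Q₁ : Matrix (Fin T₁) (Fin N) ℝ}
    {Q₂ : Matrix (Fin T₂) (Fin N) ℝ} {A : Tensor F T₁ T₂}
    (hmin : ∀ Q', S.objective (P, Q₁, Q₂, A) ≤ S.objective (P, Q', Q₂, A))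
    (D : Matrix (Fin T₁) (Fin N) ℝ) :
    0 ≤ entrySum (S.fitGrad (P, Q₁, Q₂, A) * cpd P D Q₂) + S.lam * matInner Q₁ D := by
  have h := S.smoothDeriv_nonneg (z := (P, Q₁, Q₂, A)) (d := (0, D, 0, 0)) rfl
    fun t => by simpa using hmin (Q₁ + t • D)
  simpa [smoothDeriv, cpd_zero_left, cpd_zero_right, modeProd_zero, entrySum_zero, matInner_zero]
    using h

lemma smoothDeriv_nonneg_Q₂ {P : Matrix (Fin E) (Fin N) ℝ} {Q₁ : Matrix (Fin T₁) (Fin N) ℝ}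
    {Q₂ : Matrix (Fin T₂) (Fin N) ℝ} {A : Tensor F T₁ T₂}
    (hmin : ∀ Q', S.objective (P, Q₁, Q₂, A) ≤ S.objective (P, Q₁, Q', A))
    (D : Matrix (Fin T₂) (Fin N) ℝ) :
    0 ≤ entrySum (S.fitGrad (P, Q₁, Q₂, A) * cpd P Q₁ D) + S.lam * matInner Q₂ D := by
  have h := S.smoothDeriv_nonneg (z := (P, Q₁, Q₂, A)) (d := (0, 0, D, 0)) rfl
    fun t => by simpa using hmin (Q₂ + t • D)
  simpa [smoothDeriv, cpd_zero_left, cpd_zero_mid, modeProd_zero, entrySum_zero, matInner_zero]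
    using h

lemma le_of_add_mul_matFrobSq_le {I J : ℕ} {X : Matrix (Fin I) (Fin J) ℝ} {a b : ℝ}
    (h : a + S.lam / 2 * matFrobSq X ≤ b) : a ≤ b := by
  have := mul_nonneg (half_pos S.lam_pos).le (matFrobSq_nonneg X)
  linarith

/-- A fixed point of the factor updates at which the line search slope is nonnegative is
stationary. -/
lemma isStationaryPoint_of_fixed {z : Point E F T₁ T₂ N} (hz : S.sweep z = z)
    (hs : 0 ≤ S.slope (cpd z.1 z.2.1 z.2.2.1)
      (S.bestResponse (cpd z.1 z.2.1 z.2.2.1) z.2.2.2) z.2.2.2) :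
    IsStationaryPoint (S.objective (N := N)) z := by
  intro d
  obtain ⟨P, Q₁, Q₂, A⟩ := z
  have hP : S.updateP Q₁ Q₂ A = P := congrArg Prod.fst hz
  have hQ₁ : S.updateQ₁ (S.updateP Q₁ Q₂ A) Q₂ A = Q₁ := congrArg (fun w => w.2.1) hz
  have hQ₂ : S.updateQ₂ (S.updateP Q₁ Q₂ A) (S.updateQ₁ (S.updateP Q₁ Q₂ A) Q₂ A) A = Q₂ :=
    congrArg (fun w => w.2.2.1) hz
  -- `hQ₁` must be used in its nested form here, before `hP` simplifies it.
  rw [hQ₁, hP] at hQ₂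
  rw [hP] at hQ₁
  have h1 := S.smoothDeriv_nonneg_P (P := P) (Q₁ := Q₁) (Q₂ := Q₂) (A := A) (fun P' => by
    have := S.objective_updateP_add_le P' Q₁ Q₂ A
    rw [hP] at this
    exact S.le_of_add_mul_matFrobSq_le this) d.1
  have h2 := S.smoothDeriv_nonneg_Q₁ (P := P) (Q₁ := Q₁) (Q₂ := Q₂) (A := A) (fun Q' => by
    have := S.objective_updateQ₁_add_le P Q' Q₂ A
    rw [hQ₁] at this
    exact S.le_of_add_mul_matFrobSq_le this) d.2.1
  have h3 := S.smoothDeriv_nonneg_Q₂ (P := P) (Q₁ := Q₁) (Q₂ := Q₂) (A := A) (fun Q' => by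
    have := S.objective_updateQ₂_add_le P Q₁ Q' A
    rw [hQ₂] at this
    exact S.le_of_add_mul_matFrobSq_le this) d.2.2.1
  choose s hs' using fun i j k => exists_hasDerivWithinAt_abs (A i j k) (d.2.2.2 i j k)
  have h4 : 0 ≤ entrySum (S.fitGrad (P, Q₁, Q₂, A) * modeProd d.2.2.2 S.R)
      + ∑ i, ∑ j, ∑ k, S.M i j k * s i j k := by
    rw [entrySum_mul_modeProd]
    simp only [← sum_add_distrib]
    -- After the adjoint identity, the coefficient of each direction entry is `gradA` by unfolding.
    exact sum_nonneg fun i _ => sum_nonneg fun j _ => sum_nonneg fun k _ =>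
      scalarModel_directional_nonneg (S.scalarModel_le_of_slope_nonneg hs i j k) (hs' i j k)
  refine ⟨_, ?_, (S.hasDerivAt_smoothPart (P, Q₁, Q₂, A) d).hasDerivWithinAt.add
    (S.hasDerivWithinAt_l1norm hs')⟩
  simp only [smoothDeriv]
  linarith

end Problem

end TBSCA

end

/-- In this finite-dimensional space, cluster points along `Filter.atTop` are exactly the limits of
subsequences. -/
theorem proposition1 {E F T₁ T₂ N : ℕ} (S : TBSCA.Problem E F T₁ T₂)
    (z₀ z : TBSCA.Point E F T₁ T₂ N)
    (hz : MapClusterPt z Filter.atTop (S.iterate z₀)) :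
    TBSCA.IsStationaryPoint (S.objective (N := N)) z :=
  S.isStationaryPoint_of_fixed (S.sweep_eq_self_of_mapClusterPt hz)
    (S.slope_nonneg_of_mapClusterPt hz)
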